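/- Let $r,d,m$ be integers with $1\le r<d$ and $m\ge 1$. The recursive circulant $G(N,d)$ is the (simple, undirected) graph with vertex set $\{0,1,\dots,N-1\}$ in which distinct $v,w$ are adjacent if and only if $v+d^i\equiv w$ or $w+d^i\equiv v \pmod N$ for some integer $i$ with $0\le i\le\lceil\log_d N\rceil-1$. For an edge-coloring (not necessarily proper), a path is rainbow if no two of its edges have the same color. For a connected graph $G$, $rc(G)$ (respectively $src(G)$) is the least $k$ for which $G$ has an edge-coloring with $k$ colors such that every two distinct vertices $u,v$ are connected by a rainbow path (respectively by a rainbow path of length equal to the distance $d(u,v)$). Write $G=G(rd^m,d)$. (i) If $r\ge 4$ and $d\ge 5$, then $$rc(G)\le src(G)\le\begin{cases}\frac d2 m+\lceil r/2\rceil & d\text{ even},\\ \lfloor\frac d2\rfloor m+\lceil r/2\rceil & d\text{ odd and } r=\lfloor\frac d2\rfloor,\\ (\lfloor\frac d2\rfloor+r)m+\lceil r/2\rceil & d\text{ odd and } r<\lfloor\frac d2\rfloor,\\ rm+\lceil r/2\rceil & d\text{ odd and } r>\lfloor\frac d2\rfloor.\end{cases}$$ In particular, if moreover $d=2r+1$ and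 $r$ is even, then $rc(G)=src(G)=rm+r/2$. (ii) If $r\le 3$ and $d\ge 4$, then $$rc(G)\le src(G)\le\begin{cases}\frac d2 m+\lfloor r/2\rfloor & d\text{ even},\\ \lfloor\frac d2\rfloor m+\lfloor r/2\rfloor & d\text{ odd and } r=\lfloor\frac d2\rfloor,\\ (\lfloor\frac d2\rfloor+r)m+\lfloor r/2\rfloor & d\text{ odd and } r<\lfloor\frac d2\rfloor,\\ rm+\lfloor r/2\rfloor & d\text{ odd and } r>\lfloor\frac d2\rfloor.\end{cases}$$ In particular, if $r=3$ and $d=7$, then $rc(G)=src(G)=3m+1$. (iii) If $d=3$, then $rc(G(r3^m,3))=src(G(r3^m,3))=m+\lfloor r/2\rfloor$. (iv) If $d=2$ (so that $r=1$), then $\lfloor m/2\rfloor\le rc(G(2^m,2))\le src(G(2^m,2))\le\lceil m/2\rceil$. In particular, if $m$ is even, then $rc(G(2^m,2))=src(G(2^m,2))=m/2$. -/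

import Mathlib

namespace Rainbow

/-- A walk is a rainbow path with respect to an edge-coloring `c` if it is a path and no two
(distinct) edges of it have the same color. The coloring need not be proper. -/
def IsRainbowPath {V K : Type*} {G : SimpleGraph V} (c : G.edgeSet → K) {u v : V}
    (p : G.Walk u v) : Prop :=
  p.IsPath ∧ Set.InjOn c {e : G.edgeSet | (e : Sym2 V) ∈ p.edges}

/-- Every two distinct vertices are connected by a rainbow path. -/
def IsRainbowColoring {V K : Type*} (G : SimpleGraph V) (c : G.edgeSet → K) : Prop :=
  ∀ u v : V, u ≠ v → ∃ p : G.Walk u v, IsRainbowPath c p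

/-- Every two distinct vertices are connected by a rainbow path whose length is their distance. -/
def IsStrongRainbowColoring {V K : Type*} (G : SimpleGraph V) (c : G.edgeSet → K) : Prop :=
  ∀ u v : V, u ≠ v → ∃ p : G.Walk u v, IsRainbowPath c p ∧ p.length = G.dist u v

/-- The rainbow connection number: the least `k` such that some `k`-edge-coloring is a rainbow
coloring; it is `0` (as `sInf ∅ = 0`) for disconnected graphs, which is the usual convention. -/
noncomputable def rc {V : Type*} (G : SimpleGraph V) : ℕ :=
  sInf {k : ℕ | ∃ c : G.edgeSet → Fin k, IsRainbowColoring G c}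

/-- The strong rainbow connection number. -/
noncomputable def src {V : Type*} (G : SimpleGraph V) : ℕ :=
  sInf {k : ℕ | ∃ c : G.edgeSet → Fin k, IsStrongRainbowColoring G c}

/-- For a finite connected graph the minimum in `src` is over a nonempty set. -/
theorem exists_strongRainbowColoring {V : Type*} [Finite V] (G : SimpleGraph V)
    (hG : G.Connected) :
    ∃ (k : ℕ) (c : G.edgeSet → Fin k), IsStrongRainbowColoring G c := by
  obtain ⟨k, ⟨f⟩⟩ := Finite.exists_equiv_fin G.edgeSet
  refine ⟨k, f, fun u v _ => ?_⟩
  obtain ⟨p, hp, hl⟩ := hG.exists_path_of_dist u v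
  exact ⟨p, ⟨hp, f.injective.injOn⟩, hl⟩

/-- The recursive circulant `G(N, d)`: the vertices are the residues modulo `N`, and distinct `v`,
`w` are adjacent iff `v + d ^ i ≡ w` or `w + d ^ i ≡ v` modulo `N` for some
`0 ≤ i ≤ ⌈log_d N⌉ - 1`; here `Nat.clog d N` is `⌈log_d N⌉`. -/
def recursiveCirculant (N d : ℕ) : SimpleGraph (ZMod N) :=
  SimpleGraph.fromRel fun v w => ∃ i < Nat.clog d N, v + (d : ZMod N) ^ i = w

end Rainbow

/-! `G(N,d)` is a Cayley graph of an abelian group, so a walk from `u` to `v` amounts to digits `a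
i` with `∑ a i * d ^ i = v - u`, and the distance is the least `∑ |a i|`. Carrying never raises this
cost, so geodesic digits can be taken with `|a i| ≤ d / 2` for `i < m` and `|a m| ≤ r / 2`
(`exists_balanced_digits`).

The jumps of size `d ^ i` form cycles of length `r * d ^ (m - i)`. Give each level its own palette
and color every cycle so that any `d / 2` consecutive edges (`r / 2` on the top level) differ.
Walking the levels in order is then a rainbow geodesic (`src_le_of_hasWindowColoring`), and the
bounds count the colors such cyclic colorings use. For `d = 2` digits can be chosen with at most one
nonzero entry per pair of levels, so each pair shares a color.

A rainbow path is no longer than the number of colors, so distances bound `rc` below. The far points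
have all digits `k` and top digit `r / 2` when `d = 2 * k + 1`, and are `1 + 4 + 16 + ⋯` when `d =
2`. -/

namespace Rainbow

open Finset

/-! ### Rainbow connection in general graphs -/

section General

variable {V : Type*} {G : SimpleGraph V}

theorem IsStrongRainbowColoring.isRainbowColoring {K : Type*} {c : G.edgeSet → K}
    (h : IsStrongRainbowColoring G c) : IsRainbowColoring G c := fun u v huv =>
  (h u v huv).imp fun _ hp => hp.1

theorem rc_le_src [Finite V] (hG : G.Connected) : rc G ≤ src G := by
  obtain ⟨c, hc⟩ := Nat.sInf_mem (s := {k : ℕ | ∃ c : G.edgeSet → Fin k,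
    IsStrongRainbowColoring G c}) (exists_strongRainbowColoring G hG)
  exact Nat.sInf_le ⟨c, hc.isRainbowColoring⟩

theorem IsRainbowPath.length_le {k : ℕ} {c : G.edgeSet → Fin k} {u v : V} {p : G.Walk u v}
    (h : IsRainbowPath c p) : p.length ≤ k := by
  classical
  obtain ⟨hp, hc⟩ := h
  have hnd : (p.edges.attach.map fun e => c ⟨e.1, p.edges_subset_edgeSet e.2⟩).Nodup := by
    refine List.Nodup.map_on ?_ (List.nodup_attach.mpr hp.isTrail.edges_nodup)
    intro x _ y _ hxy
    have := hc (x₁ := ⟨x.1, p.edges_subset_edgeSet x.2⟩) (x₂ := ⟨y.1, p.edges_subset_edgeSet y.2⟩)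
      x.2 y.2 hxy
    exact Subtype.ext (congrArg (fun e : G.edgeSet => (e : Sym2 V)) this)
  simpa using hnd.length_le_card

theorem dist_le_rc [Finite V] (hG : G.Connected) (u v : V) : G.dist u v ≤ rc G := by
  obtain ⟨k, c, hc⟩ := exists_strongRainbowColoring G hG
  -- Nonemptiness rules out the default value `sInf ∅ = 0`.
  refine le_csInf ⟨k, c, hc.isRainbowColoring⟩ ?_
  rintro k ⟨c, hc⟩
  by_cases huv : u = v
  · simp [huv]
  · obtain ⟨p, hp⟩ := hc u v huv
    exact (SimpleGraph.dist_le p).trans hp.length_le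

end General

/-! ### Walks as digit vectors -/

variable {N d : ℕ}

theorem recursiveCirculant_adj {v w : ZMod N} : (recursiveCirculant N d).Adj v w ↔
    v ≠ w ∧ ((∃ i < Nat.clog d N, v + (d : ZMod N) ^ i = w) ∨
      ∃ i < Nat.clog d N, w + (d : ZMod N) ^ i = v) :=
  SimpleGraph.fromRel_adj _ _ _

/-- The group is abelian, so only the net number of steps on each level matters; cancellation can
only shorten. -/
theorem exists_digits_of_walk {u v : ZMod N} (p : (recursiveCirculant N d).Walk u v) :
    ∃ a : ℕ → ℤ, ∑ i ∈ range (Nat.clog d N), (a i : ZMod N) * (d : ZMod N) ^ i = v - u ∧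
      ∑ i ∈ range (Nat.clog d N), (a i).natAbs ≤ p.length := by
  induction p with
  | nil => exact ⟨0, by simp⟩
  | @cons u v w h p ih =>
    obtain ⟨a, ha, hl⟩ := ih
    obtain ⟨ε, i, hi, hε, hv⟩ : ∃ (ε : ℤ) (i : ℕ), i < Nat.clog d N ∧ ε.natAbs = 1 ∧
        v - u = (ε : ZMod N) * (d : ZMod N) ^ i := by
      rcases (recursiveCirculant_adj.1 h).2 with ⟨i, hi, h⟩ | ⟨i, hi, h⟩
      · exact ⟨1, i, hi, rfl, by rw [← h]; push_cast; ring⟩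
      · exact ⟨-1, i, hi, rfl, by rw [← h]; push_cast; ring⟩
    refine ⟨fun j => a j + if j = i then ε else 0, ?_, ?_⟩
    · have : ∑ j ∈ range (Nat.clog d N), ((if j = i then ε else 0 : ℤ) : ZMod N) *
          (d : ZMod N) ^ j = (ε : ZMod N) * (d : ZMod N) ^ i := by
        rw [Finset.sum_eq_single_of_mem i (mem_range.2 hi)]
        · simp
        · intro j _ hj; simp [hj]
      simp only [Int.cast_add, add_mul, Finset.sum_add_distrib]
      rw [ha, this, ← hv]; ring
    · have : ∑ j ∈ range (Nat.clog d N), (if j = i then ε else 0 : ℤ).natAbs = 1 := by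
        rw [Finset.sum_eq_single_of_mem i (mem_range.2 hi)]
        · simpa using hε
        · intro j _ hj; simp [hj]
      rw [SimpleGraph.Walk.length_cons]
      calc _ ≤ ∑ j ∈ range (Nat.clog d N), ((a j).natAbs + (if j = i then ε else 0 : ℤ).natAbs) :=
            Finset.sum_le_sum fun j _ => Int.natAbs_add_le _ _
        _ ≤ _ := by rw [Finset.sum_add_distrib]; omega

theorem pow_lt_of_lt_clog {i : ℕ} (hd : 1 < d) (hi : i < Nat.clog d N) : d ^ i < N :=
  (Nat.lt_clog_iff_pow_lt hd).1 hi

theorem natCast_ne_zero_of_lt {x : ℕ} (h0 : 0 < x) (h : x < N) : (x : ZMod N) ≠ 0 := by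
  rw [Ne, ZMod.natCast_eq_zero_iff]
  exact fun hx => absurd (Nat.le_of_dvd h0 hx) (by omega)

theorem adj_add_pow {i : ℕ} (hd : 1 < d) (hi : i < Nat.clog d N) (v : ZMod N) :
    (recursiveCirculant N d).Adj v (v + (d : ZMod N) ^ i) := by
  refine recursiveCirculant_adj.2 ⟨?_, Or.inl ⟨i, hi, rfl⟩⟩
  have := natCast_ne_zero_of_lt (pow_pos (by omega : 0 < d) i) (pow_lt_of_lt_clog hd hi)
  intro h
  apply this
  push_cast
  simpa using h.symm

theorem exists_straight_walk {i : ℕ} (hd : 1 < d) (hi : i < Nat.clog d N) (w : ZMod N) (c : ℕ) :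
    ∃ p : (recursiveCirculant N d).Walk w (w + c * (d : ZMod N) ^ i), p.length = c ∧
      ∀ e ∈ p.edges, ∃ j < c, e = s(w + j * (d : ZMod N) ^ i,
        w + j * (d : ZMod N) ^ i + (d : ZMod N) ^ i) := by
  induction c with
  | zero => exact ⟨SimpleGraph.Walk.nil.copy rfl (by simp), by simp, by simp⟩
  | succ c ih =>
    obtain ⟨p, hp, he⟩ := ih
    refine ⟨(p.concat (adj_add_pow hd hi _)).copy rfl (by push_cast; ring), by simp [hp], ?_⟩
    intro e h
    simp only [SimpleGraph.Walk.edges_copy, SimpleGraph.Walk.edges_concat, List.concat_eq_append,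
      List.mem_append, List.mem_singleton] at h
    rcases h with h | h
    · obtain ⟨j, hj, h⟩ := he e h
      exact ⟨j, by omega, h⟩
    · exact ⟨c, by omega, h⟩

theorem exists_signed_walk {i : ℕ} (hd : 1 < d) (hi : i < Nat.clog d N) (u : ZMod N) (a : ℤ) :
    ∃ (w : ZMod N) (p : (recursiveCirculant N d).Walk u (u + a * (d : ZMod N) ^ i)),
      p.length = a.natAbs ∧ ∀ e ∈ p.edges, ∃ j < a.natAbs, e = s(w + j * (d : ZMod N) ^ i,
        w + j * (d : ZMod N) ^ i + (d : ZMod N) ^ i) := by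
  rcases Int.eq_nat_or_neg a with ⟨c, rfl | rfl⟩
  · obtain ⟨p, hp, he⟩ := exists_straight_walk hd hi u c
    exact ⟨u, p.copy rfl (by simp), by simpa using hp, by simpa using he⟩
  -- A negative digit is a forward run traversed backwards, so its edges are still indexed by their
  -- forward starts.
  · obtain ⟨p, hp, he⟩ := exists_straight_walk hd hi (u + ((-c : ℤ) : ZMod N) * (d : ZMod N) ^ i) c
    refine ⟨u + ((-c : ℤ) : ZMod N) * (d : ZMod N) ^ i,
      (p.copy rfl (by push_cast; ring)).reverse, by simpa using hp, ?_⟩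
    simpa using he

/-- Taking the levels in increasing order, the walk uses on level `i` one run of `|a i|` consecutive
jumps, starting at `w i`. -/
theorem exists_walk_of_digits (hd : 1 < d) (u : ZMod N) (a : ℕ → ℤ) {n : ℕ}
    (hn : n ≤ Nat.clog d N) :
    ∃ (w : ℕ → ZMod N) (p : (recursiveCirculant N d).Walk u
        (u + ∑ i ∈ range n, (a i : ZMod N) * (d : ZMod N) ^ i)),
      p.length = ∑ i ∈ range n, (a i).natAbs ∧
      ∀ e ∈ p.edges, ∃ i < n, ∃ j < (a i).natAbs, e = s(w i + j * (d : ZMod N) ^ i,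
        w i + j * (d : ZMod N) ^ i + (d : ZMod N) ^ i) := by
  induction n with
  | zero =>
    refine ⟨0, SimpleGraph.Walk.nil.copy rfl (by simp), ?_, ?_⟩
    · rw [SimpleGraph.Walk.length_copy]; simp
    · rw [SimpleGraph.Walk.edges_copy]; simp
  | succ n ih =>
    obtain ⟨w, p, hp, he⟩ := ih (by omega)
    obtain ⟨x, q, hq, hf⟩ := exists_signed_walk hd (show n < Nat.clog d N by omega)
      (u + ∑ i ∈ range n, (a i : ZMod N) * (d : ZMod N) ^ i) (a n)
    refine ⟨fun i => if i = n then x else w i,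
      (p.append q).copy rfl (by rw [sum_range_succ]; ring), ?_, ?_⟩
    · simp [hp, hq, sum_range_succ]
    · intro e h
      simp only [SimpleGraph.Walk.edges_copy, SimpleGraph.Walk.edges_append,
        List.mem_append] at h
      rcases h with h | h
      · obtain ⟨i, hi, j, hj, h⟩ := he e h
        refine ⟨i, by omega, j, hj, ?_⟩
        simpa [show i ≠ n by omega] using h
      · obtain ⟨j, hj, h⟩ := hf e h
        exact ⟨n, by omega, j, hj, by simpa using h⟩

theorem connected_recursiveCirculant [NeZero N] (hd : 1 < d) (hN : 1 < N) :
    (recursiveCirculant N d).Connected := by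
  have h0 : 0 < Nat.clog d N := Nat.clog_pos hd hN
  refine (SimpleGraph.connected_iff _).2 ⟨fun u v => ?_, ⟨0⟩⟩
  obtain ⟨p, -⟩ := exists_straight_walk hd h0 u (v - u).val
  exact ⟨p.copy rfl (by simp)⟩

/-- The digit vector `a` represents `x` in base `d` with as few steps as possible. -/
def IsGeodesicDigits (N d : ℕ) (x : ZMod N) (a : ℕ → ℤ) : Prop :=
  ∑ i ∈ range (Nat.clog d N), (a i : ZMod N) * (d : ZMod N) ^ i = x ∧
  ∀ b : ℕ → ℤ, ∑ i ∈ range (Nat.clog d N), (b i : ZMod N) * (d : ZMod N) ^ i = x →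
    ∑ i ∈ range (Nat.clog d N), (a i).natAbs ≤ ∑ i ∈ range (Nat.clog d N), (b i).natAbs

theorem exists_isGeodesicDigits [NeZero N] (hd : 1 < d) (hN : 1 < N) (x : ZMod N) :
    ∃ a, IsGeodesicDigits N d x a := by
  obtain ⟨p, hp⟩ := (connected_recursiveCirculant hd hN).exists_walk_length_eq_dist 0 x
  obtain ⟨a, ha, hl⟩ := exists_digits_of_walk p
  refine ⟨a, by rw [ha, sub_zero], fun b hb => hl.trans ?_⟩
  obtain ⟨-, q, hq, -⟩ := exists_walk_of_digits hd (0 : ZMod N) b le_rfl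
  rw [hp, ← hq]
  have hx := SimpleGraph.dist_le (q.copy rfl (by rw [hb, zero_add] : _ = x))
  rwa [SimpleGraph.Walk.length_copy] at hx

/-- If the orientations disagree, `d ^ i + d ^ i'` vanishes modulo `N`; two distinct powers, each at
most `N / 2`, have a sum strictly between `0` and `N`. -/
theorem level_unique {i i' : ℕ} (hd : 1 < d) (h2 : ∀ i < Nat.clog d N, 2 * d ^ i ≤ N)
    (hi : i < Nat.clog d N) (hi' : i' < Nat.clog d N) {v v' : ZMod N}
    (h : s(v, v + (d : ZMod N) ^ i) = s(v', v' + (d : ZMod N) ^ i')) : i = i' := by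
  rcases Sym2.eq_iff.1 h with ⟨rfl, h⟩ | ⟨h, h'⟩
  · have h : ((d ^ i : ℕ) : ZMod N) = ((d ^ i' : ℕ) : ZMod N) := by
      push_cast; exact add_left_cancel h
    rw [ZMod.natCast_eq_natCast_iff', Nat.mod_eq_of_lt (pow_lt_of_lt_clog hd hi),
      Nat.mod_eq_of_lt (pow_lt_of_lt_clog hd hi')] at h
    exact Nat.pow_right_injective hd h
  · by_contra hne
    have hz : ((d ^ i + d ^ i' : ℕ) : ZMod N) = 0 := by
      push_cast
      rw [h] at h'
      linear_combination h'
    refine natCast_ne_zero_of_lt (by positivity) ?_ hz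
    have h1 := h2 i hi
    have h1' := h2 i' hi'
    have : d ^ i ≠ d ^ i' := fun h => hne (Nat.pow_right_injective hd h)
    omega

/-- When `2 * d ^ i = 0` the jump goes from either end to the other, and the start is ambiguous;
this is the only obstruction. -/
theorem start_unique {i : ℕ} (h2 : (2 * (d : ZMod N) ^ i) ≠ 0) {v v' : ZMod N}
    (h : s(v, v + (d : ZMod N) ^ i) = s(v', v' + (d : ZMod N) ^ i)) : v = v' := by
  rcases Sym2.eq_iff.1 h with ⟨h, -⟩ | ⟨h, h'⟩
  · exact h
  · rw [h] at h'
    exact absurd (by linear_combination h') h2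

theorem exists_level_start (e : (recursiveCirculant N d).edgeSet) :
    ∃ (i : ℕ) (v : ZMod N), i < Nat.clog d N ∧ (e : Sym2 (ZMod N)) = s(v, v + (d : ZMod N) ^ i) := by
  obtain ⟨e, he⟩ := e
  induction e with
  | _ v w =>
    rcases (recursiveCirculant_adj.1 he).2 with ⟨i, hi, h⟩ | ⟨i, hi, h⟩
    · exact ⟨i, v, hi, by rw [h]⟩
    · exact ⟨i, w, hi, by rw [h]; exact Sym2.eq_swap⟩

/-- A coloring `κ` of the jumps `v ↦ v + d ^ i` by level and start, for which each group element has
geodesic digits with no repeated color, gives a strong rainbow coloring. -/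
theorem src_le_of_level_coloring (hd : 1 < d) (h2 : ∀ i < Nat.clog d N, 2 * d ^ i ≤ N) {k : ℕ}
    (κ : ℕ → ZMod N → ℕ) (hκ : ∀ i < Nat.clog d N, ∀ x, κ i x < k)
    (H : ∀ x : ZMod N, ∃ a, IsGeodesicDigits N d x a ∧
      (∀ i < Nat.clog d N, ∀ i' < Nat.clog d N, a i ≠ 0 → a i' ≠ 0 → ∀ y y', κ i y = κ i' y' →
        i = i') ∧
      ∀ i < Nat.clog d N, 2 ≤ (a i).natAbs → (2 * (d : ZMod N) ^ i) ≠ 0 ∧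
        ∀ w, ∀ j < (a i).natAbs, ∀ j' < (a i).natAbs,
          κ i (w + j * (d : ZMod N) ^ i) = κ i (w + j' * (d : ZMod N) ^ i) → j = j') :
    src (recursiveCirculant N d) ≤ k := by
  choose lev start hlev hstart using exists_level_start (N := N) (d := d)
  refine Nat.sInf_le ⟨fun e => ⟨κ (lev e) (start e), hκ _ (hlev e) _⟩, fun u v _ => ?_⟩
  obtain ⟨a, ⟨hsum, hmin⟩, hl, hs⟩ := H (v - u)
  obtain ⟨w, p, hp, he⟩ := exists_walk_of_digits hd u a le_rfl
  have huv : u + ∑ i ∈ range (Nat.clog d N), (a i : ZMod N) * (d : ZMod N) ^ i = v := by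
    rw [hsum]; ring
  have hpd : (p.copy rfl huv).length = (recursiveCirculant N d).dist u v := by
    refine le_antisymm ?_ (SimpleGraph.dist_le _)
    obtain ⟨q, hq⟩ := (p.copy rfl huv).reachable.exists_walk_length_eq_dist
    obtain ⟨b, hb, hbl⟩ := exists_digits_of_walk q
    rw [SimpleGraph.Walk.length_copy, hp, ← hq]
    exact (hmin b hb).trans hbl
  refine ⟨p.copy rfl huv, ⟨SimpleGraph.Walk.isPath_of_length_eq_dist _ hpd, ?_⟩, hpd⟩
  intro e h e' h' hc
  simp only [SimpleGraph.Walk.edges_copy, Set.mem_ofPred_eq] at h h'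
  obtain ⟨i, hi, j, hj, h⟩ := he _ h
  obtain ⟨i', hi', j', hj', h'⟩ := he _ h'
  have hei : lev e = i := level_unique hd h2 (hlev e) hi ((hstart e).symm.trans h)
  have hei' : lev e' = i' := level_unique hd h2 (hlev e') hi' ((hstart e').symm.trans h')
  have hc : κ (lev e) (start e) = κ (lev e') (start e') := congrArg Fin.val hc
  have hii : i = i' := by
    refine hl i hi i' hi' ?_ ?_ (start e) (start e') (by rwa [hei, hei'] at hc)
    · intro h0; simp [h0] at hj
    · intro h0; simp [h0] at hj'
  subst hii
  have hjj : j = j' := by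
    by_cases h2 : 2 ≤ (a i).natAbs
    · obtain ⟨h20, hinj⟩ := hs i hi h2
      have h1 := (hstart e).symm.trans h
      have h1' := (hstart e').symm.trans h'
      rw [hei] at h1 hc
      rw [hei'] at h1' hc
      rw [start_unique h20 h1, start_unique h20 h1'] at hc
      exact hinj (w i) j hj j' hj' hc
    · omega
  subst hjj
  exact Subtype.ext (h.trans h'.symm)

end Rainbow
-- Carrying in integer digit vectors
namespace Rainbow

open Finset

/-- If `|a| > d / 2`, moving `a` by `d` towards zero lowers `|a|` by at least one, which pays for
the carry. -/
theorem exists_balanced_remainder {d : ℕ} (hd : 1 ≤ d) (a : ℤ) :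
    ∃ b t : ℤ, a = b + d * t ∧ 2 * b.natAbs ≤ d ∧ b.natAbs + t.natAbs ≤ a.natAbs := by
  induction h : a.natAbs using Nat.strong_induction_on generalizing a with
  | _ n ih =>
    by_cases hs : 2 * a.natAbs ≤ d
    · exact ⟨a, 0, by simp, hs, by simp [h]⟩
    · rcases le_total 0 a with h0 | h0
      · obtain ⟨b, t, h1, h2, h3⟩ := ih (a - d).natAbs (by omega) _ rfl
        exact ⟨b, t + 1, by linear_combination h1, h2, by omega⟩
      · obtain ⟨b, t, h1, h2, h3⟩ := ih (a + d).natAbs (by omega) _ rfl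
        exact ⟨b, t - 1, by linear_combination h1, h2, by omega⟩

theorem sum_digits_succ (a : ℕ → ℤ) (d : ℤ) (n : ℕ) :
    ∑ i ∈ range (n + 1), a i * d ^ i = a 0 + d * ∑ i ∈ range n, a (i + 1) * d ^ i := by
  rw [sum_range_succ', mul_sum]
  simp only [pow_succ, pow_zero, mul_one]
  rw [add_comm]
  congr 1
  exact sum_congr rfl fun i _ => by ring

theorem sum_natAbs_succ (a : ℕ → ℤ) (n : ℕ) :
    ∑ i ∈ range (n + 1), (a i).natAbs = (a 0).natAbs + ∑ i ∈ range n, (a (i + 1)).natAbs := by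
  rw [sum_range_succ', add_comm]

/-- The digits `b` shifted up by one place, with the new lowest digit `x`. -/
def consDigit (x : ℤ) (b : ℕ → ℤ) : ℕ → ℤ
  | 0 => x
  | i + 1 => b i

@[simp] theorem consDigit_zero (x : ℤ) (b : ℕ → ℤ) : consDigit x b 0 = x := rfl

@[simp] theorem consDigit_succ (x : ℤ) (b : ℕ → ℤ) (i : ℕ) : consDigit x b (i + 1) = b i := rfl

/-- The digits `a` with the carry `t` added to the lowest one. -/
def addCarry (a : ℕ → ℤ) (t : ℤ) (i : ℕ) : ℤ := a i + if i = 0 then t else 0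

theorem sum_addCarry (a : ℕ → ℤ) (t d : ℤ) {n : ℕ} (hn : 0 < n) :
    ∑ i ∈ range n, addCarry a t i * d ^ i = ∑ i ∈ range n, a i * d ^ i + t := by
  obtain ⟨n, rfl⟩ := Nat.exists_eq_succ_of_ne_zero hn.ne'
  simp only [Nat.succ_eq_add_one, sum_range_succ', addCarry]
  simp; ring

theorem sum_natAbs_addCarry_le (a : ℕ → ℤ) (t : ℤ) (n : ℕ) :
    ∑ i ∈ range n, (addCarry a t i).natAbs ≤ ∑ i ∈ range n, (a i).natAbs + t.natAbs := by
  cases n with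
  | zero => simp
  | succ n =>
    simp only [sum_range_succ', addCarry]
    simp
    omega

theorem exists_balanced_digits {d r : ℕ} (hd : 1 ≤ d) (hr : 1 ≤ r) (m : ℕ) (a : ℕ → ℤ) :
    ∃ b : ℕ → ℤ,
      (∃ s : ℤ, ∑ i ∈ range (m + 1), a i * (d : ℤ) ^ i =
        ∑ i ∈ range (m + 1), b i * (d : ℤ) ^ i + s * (r * d ^ m)) ∧
      ∑ i ∈ range (m + 1), (b i).natAbs ≤ ∑ i ∈ range (m + 1), (a i).natAbs ∧
      (∀ i < m, 2 * (b i).natAbs ≤ d) ∧ 2 * (b m).natAbs ≤ r := by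
  induction m generalizing a with
  | zero =>
    -- The top digit is reduced modulo `r`; its carry is a multiple of the modulus `r * d ^ m` and
    -- is discarded into `s`.
    obtain ⟨b, t, h1, h2, h3⟩ := exists_balanced_remainder hr (a 0)
    exact ⟨fun _ => b, ⟨t, by simp [h1]; ring⟩, by simp; omega, by simp, h2⟩
  | succ m ih =>
    obtain ⟨x, t, h1, h2, h3⟩ := exists_balanced_remainder hd (a 0)
    obtain ⟨b, ⟨s, hs⟩, hc, hb, hbm⟩ := ih (addCarry (fun i => a (i + 1)) t)
    have hc' := sum_natAbs_addCarry_le (fun i => a (i + 1)) t (m + 1)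
    rw [sum_addCarry _ _ _ (Nat.succ_pos m), Nat.succ_eq_add_one] at hs
    refine ⟨consDigit x b, ⟨s, ?_⟩, ?_, ?_, hbm⟩
    · rw [sum_digits_succ _ _ (m + 1), sum_digits_succ _ _ (m + 1), h1]
      simp only [consDigit_zero, consDigit_succ]
      linear_combination (d : ℤ) * hs
    · rw [sum_natAbs_succ _ (m + 1), sum_natAbs_succ _ (m + 1)]
      simp only [consDigit_zero, consDigit_succ]
      omega
    · rintro (_ | i) hi
      · exact h2
      · exact hb i (by omega)

/-- Two binary digits act as one base-4 digit, and each residue `-1, 0, 1, ±2` costs at most one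
step. -/
theorem exists_sparse_pair (a b : ℤ) : ∃ x y t : ℤ, a + 2 * b = x + 2 * y + 4 * t ∧
    x.natAbs + y.natAbs ≤ 1 ∧ x.natAbs + y.natAbs + t.natAbs ≤ a.natAbs + b.natAbs := by
  have h := Int.emod_add_mul_ediv (a + 2 * b) 4
  have h0 := Int.emod_nonneg (a + 2 * b) (show (4 : ℤ) ≠ 0 by norm_num)
  have h4 := Int.emod_lt_of_pos (a + 2 * b) (show (0 : ℤ) < 4 by norm_num)
  generalize (a + 2 * b) % 4 = e at *
  generalize (a + 2 * b) / 4 = t at *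
  obtain rfl | rfl | rfl | rfl : e = 0 ∨ e = 1 ∨ e = 2 ∨ e = 3 := by omega
  · exact ⟨0, 0, t, by omega, by simp, by omega⟩
  · exact ⟨1, 0, t, by omega, by simp, by omega⟩
  -- Residue 2 may be written `2` or `-2`; the sign of `t` selects the cheaper carry.
  · by_cases ht : 0 ≤ t
    · exact ⟨0, 1, t, by omega, by simp, by omega⟩
    · exact ⟨0, -1, t + 1, by omega, by simp, by omega⟩
  · exact ⟨-1, 0, t + 1, by omega, by simp, by omega⟩

theorem exists_sparse_digits (m : ℕ) (a : ℕ → ℤ) :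
    ∃ b : ℕ → ℤ,
      (∃ s : ℤ, ∑ i ∈ range m, a i * (2 : ℤ) ^ i = ∑ i ∈ range m, b i * (2 : ℤ) ^ i + s * 2 ^ m) ∧
      ∑ i ∈ range m, (b i).natAbs ≤ ∑ i ∈ range m, (a i).natAbs ∧
      (∀ i < m, (b i).natAbs ≤ 1) ∧
      ∀ i < m, ∀ i' < m, b i ≠ 0 → b i' ≠ 0 → i / 2 = i' / 2 → i = i' := by
  induction m using Nat.twoStepInduction generalizing a with
  | zero => exact ⟨0, ⟨0, by simp⟩, by simp⟩
  | one =>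
    refine ⟨fun _ => a 0 % 2, ⟨a 0 / 2, ?_⟩, ?_, ?_, ?_⟩
    · simpa using (Int.emod_add_ediv_mul (a 0) 2).symm
    · simp; omega
    · intro _ _; dsimp only; omega
    · intros; omega
  | more m ih _ =>
    obtain ⟨x, y, t, h1, h2, h3⟩ := exists_sparse_pair (a 0) (a 1)
    rcases Nat.eq_zero_or_pos m with rfl | hm
    · refine ⟨fun i => if i = 0 then x else y, ⟨t, ?_⟩, ?_, ?_, ?_⟩
      · simp [sum_range_succ]; linear_combination h1
      · simp [sum_range_succ]; omega
      · intro i _; dsimp only; split_ifs <;> omega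
      · intro i hi i' hi'
        dsimp only
        split_ifs <;> omega
    · obtain ⟨b, ⟨s, hs⟩, hc, hb, hbm⟩ := ih (addCarry (fun i => a (i + 2)) t)
      have hc' := sum_natAbs_addCarry_le (fun i => a (i + 2)) t m
      rw [sum_addCarry _ _ _ hm] at hs
      refine ⟨consDigit x (consDigit y b), ⟨s, ?_⟩, ?_, ?_, ?_⟩
      · simp only [sum_digits_succ, consDigit_zero, consDigit_succ, Nat.zero_add, Nat.add_assoc,
          Nat.reduceAdd]
        linear_combination h1 + 4 * hs
      · simp only [sum_natAbs_succ, consDigit_zero, consDigit_succ, Nat.zero_add, Nat.add_assoc,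
          Nat.reduceAdd]
        omega
      · rintro (_ | _ | i) hi
        · simp only [consDigit_zero]; omega
        · simp only [consDigit_zero, consDigit_succ]; omega
        · exact hb i (by omega)
      · rintro (_ | _ | i) hi (_ | _ | i') hi' h h' hii
        all_goals simp only [consDigit_zero, consDigit_succ] at h h'
        all_goals try omega
        have := hbm i (by omega) i' (by omega) h h' (by omega)
        omega

/-- The lowest digit is `k + (2 * k + 1) * t`, of absolute value at least `k + |t|`: it pays `k` and
also covers adding the carry `t` to the next digit. -/
theorem le_sum_natAbs_of_odd {k r : ℕ} (m : ℕ) (a : ℕ → ℤ) (s : ℤ)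
    (h : ∑ i ∈ range (m + 1), a i * (2 * k + 1 : ℤ) ^ i =
      ∑ i ∈ range m, (k : ℤ) * (2 * k + 1 : ℤ) ^ i + (r / 2 : ℕ) * (2 * k + 1 : ℤ) ^ m +
        s * (r * (2 * k + 1 : ℤ) ^ m)) :
    k * m + r / 2 ≤ ∑ i ∈ range (m + 1), (a i).natAbs := by
  induction m generalizing a s with
  | zero =>
    simp only [zero_add, range_one, sum_singleton, pow_zero, mul_one, range_zero, sum_empty,
      mul_zero] at h ⊢
    rcases le_or_gt 0 s with hs | hs
    · have : 0 ≤ s * r := by positivity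
      omega
    · have : s * r ≤ -r := by nlinarith
      omega
  | succ m ih =>
    have hd : (2 * k + 1 : ℤ) ≠ 0 := by omega
    rw [sum_digits_succ, sum_digits_succ (fun _ => (k : ℤ))] at h
    obtain ⟨t, ht⟩ : ∃ t : ℤ, a 0 = k + (2 * k + 1) * t := by
      refine ⟨∑ i ∈ range m, (k : ℤ) * (2 * k + 1 : ℤ) ^ i + (r / 2 : ℕ) * (2 * k + 1 : ℤ) ^ m +
        s * (r * (2 * k + 1 : ℤ) ^ m) - ∑ i ∈ range (m + 1), a (i + 1) * (2 * k + 1 : ℤ) ^ i, ?_⟩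
      rw [pow_succ] at h
      linear_combination h
    have hrec := ih (addCarry (fun i => a (i + 1)) t) s <| by
      rw [sum_addCarry _ _ _ (Nat.succ_pos m)]
      apply mul_left_cancel₀ hd
      rw [pow_succ, ht] at h
      linear_combination h
    have hc := sum_natAbs_addCarry_le (fun i => a (i + 1)) t (m + 1)
    have h0 : k + t.natAbs ≤ (a 0).natAbs := by
      rcases le_or_gt 0 t with h0 | h0
      · have : 0 ≤ k * t := by positivity
        rw [show a 0 = k + 2 * (k * t) + t by linear_combination ht]
        omega
      · have : k * t ≤ -k := by nlinarith
        rw [show a 0 = k + 2 * (k * t) + t by linear_combination ht]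
        omega
    rw [sum_natAbs_succ _ (m + 1), mul_add]
    omega

/-- The lowest pair satisfies `a 0 + 2 * a 1 = 1 + 4 * t`, which costs at least `1 + |t|`: one for
the pair, the rest for the carry. -/
theorem le_sum_natAbs_of_two (m : ℕ) (a : ℕ → ℤ) (s : ℤ)
    (h : ∑ i ∈ range m, a i * (2 : ℤ) ^ i = ∑ i ∈ range (m / 2), (4 : ℤ) ^ i + s * 2 ^ m) :
    m / 2 ≤ ∑ i ∈ range m, (a i).natAbs := by
  induction m using Nat.twoStepInduction generalizing a s with
  | zero => simp
  | one => simp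
  | more m ih _ =>
    have hdiv : (m + 2) / 2 = m / 2 + 1 := by omega
    rw [hdiv] at h ⊢
    have h4 := sum_digits_succ (fun _ => 1) 4 (m / 2)
    simp only [one_mul] at h4
    rw [h4, sum_digits_succ, sum_digits_succ, pow_add] at h
    simp only [Nat.zero_add, Nat.add_assoc, Nat.reduceAdd] at h
    obtain ⟨t, ht⟩ : ∃ t : ℤ, a 0 + 2 * a 1 = 1 + 4 * t :=
      ⟨∑ i ∈ range (m / 2), (4 : ℤ) ^ i + s * 2 ^ m - ∑ i ∈ range m, a (i + 2) * 2 ^ i,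
        by linear_combination h⟩
    have h0 : 1 + t.natAbs ≤ (a 0).natAbs + (a 1).natAbs := by omega
    simp only [sum_natAbs_succ, Nat.zero_add, Nat.add_assoc, Nat.reduceAdd]
    rcases Nat.eq_zero_or_pos m with rfl | hm
    · simp; omega
    have hrec := ih (addCarry (fun i => a (i + 2)) t) s <| by
      rw [sum_addCarry _ _ _ hm]
      linarith
    have hc := sum_natAbs_addCarry_le (fun i => a (i + 2)) t m
    omega

/-! ### Cyclic colorings with distinct colors in every window -/

/-- The cycle of length `L` has a coloring of its edges with `C` colors in which any `B` consecutive
edges have distinct colors. -/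
def HasWindowColoring (L B C : ℕ) : Prop :=
  ∃ g : ℕ → ℕ, (∀ x < L, g x < C) ∧
    ∀ q < L, ∀ j < B, ∀ j' < B, g ((q + j) % L) = g ((q + j') % L) → j = j'

theorem hasWindowColoring_of_dvd {L B C : ℕ} (hC : 0 < C) (hL : C ∣ L) (hB : B ≤ C) :
    HasWindowColoring L B C := by
  refine ⟨fun x => x % C, fun x _ => Nat.mod_lt _ hC, fun q _ j hj j' hj' h => ?_⟩
  simp only [Nat.mod_mod_of_dvd _ hL] at h
  have : j ≡ j' [MOD C] := Nat.ModEq.add_left_cancel' q h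
  exact this.eq_of_lt_of_lt (by omega) (by omega)

theorem add_mod_eq_ite {q j L : ℕ} (hq : q < L) (hj : j ≤ L) :
    (q + j) % L = if q + j < L then q + j else q + j - L := by
  split_ifs with h
  · exact Nat.mod_eq_of_lt h
  · rw [Nat.mod_eq_sub_mod (by omega), Nat.mod_eq_of_lt (by omega)]

/-- With colors `0, …, h, 0, …, h - 1`, equal colors are `h + 1` apart one way round and `h` the
other. -/
theorem hasWindowColoring_odd (h : ℕ) : HasWindowColoring (2 * h + 1) h (h + 1) := by
  refine ⟨fun x => if x < h + 1 then x else x - (h + 1), ?_, ?_⟩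
  · intro x hx; dsimp only; split_ifs <;> omega
  · intro q hq j hj j' hj' he
    rw [add_mod_eq_ite hq (by omega), add_mod_eq_ite hq (by omega)] at he
    dsimp only at he
    split_ifs at he <;> omega

/-- Color `c * k` edges periodically modulo `k` and give the last `s` edges private colors. Deleting
those leaves a periodic cycle, in which a window still meets at most `k` consecutive edges. -/
theorem hasWindowColoring_add {k s c : ℕ} (hc : 1 ≤ c) :
    HasWindowColoring (c * k + s) k (k + s) := by
  obtain ⟨c, rfl⟩ := Nat.exists_eq_add_of_le' hc
  refine ⟨fun x => if x < (c + 1) * k then x % k else k + (x - (c + 1) * k), ?_, ?_⟩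
  · intro x hx
    dsimp only
    split_ifs with h
    · have : 0 < k := by by_contra h0; simp_all
      have := Nat.mod_lt x this
      omega
    · omega
  · have key : ∀ q < (c + 1) * k + s, ∀ j j', j < j' → j' < k →
        (fun x => if x < (c + 1) * k then x % k else k + (x - (c + 1) * k))
          ((q + j) % ((c + 1) * k + s)) ≠
        (fun x => if x < (c + 1) * k then x % k else k + (x - (c + 1) * k))
          ((q + j') % ((c + 1) * k + s)) := by
      intro q hq j j' hjj hj' he
      have hk : 0 < k := by omega
      have hck : (c + 1) * k = c * k + k := by ring
      rw [add_mod_eq_ite hq (by omega), add_mod_eq_ite hq (by omega)] at he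
      have hl : ∀ x, x % k < k := fun x => Nat.mod_lt x hk
      dsimp only at he
      by_cases h1 : q + j' < (c + 1) * k
      · rw [if_pos (show q + j < _ by omega), if_pos (show q + j' < _ by omega),
          if_pos (show q + j < _ by omega), if_pos h1] at he
        have : j ≡ j' [MOD k] := Nat.ModEq.add_left_cancel' q he
        exact hjj.ne (this.eq_of_lt_of_lt (by omega) (by omega))
      · have hx := hl (q + j)
        by_cases h2 : q + j' < (c + 1) * k + s
        · rw [if_pos (show q + j < _ by omega), if_pos h2, if_neg h1] at he
          split_ifs at he <;> omega
        · rw [if_neg h2, if_pos (show q + j' - _ < _ by omega)] at he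
          by_cases h3 : q + j < (c + 1) * k + s
          · rw [if_pos h3] at he
            rw [Nat.mod_eq_of_lt (show q + j' - ((c + 1) * k + s) < k by omega)] at he
            by_cases h4 : q + j < (c + 1) * k
            · rw [if_pos h4] at he
              -- Only `q + j'` has wrapped, so `q + j` lies in the last of the `c + 1` periodic
              -- blocks.
              have h5 : (q + j) % k = q + j - c * k := by
                rw [show q + j = (q + j - c * k) + c * k by omega, Nat.add_mul_mod_self_right,
                  Nat.mod_eq_of_lt (by omega)]
                omega
              omega
            · rw [if_neg h4] at he
              omega
          · rw [if_neg h3, if_pos (show q + j - _ < _ by omega),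
              Nat.mod_eq_of_lt (by omega), Nat.mod_eq_of_lt (by omega)] at he
            omega
    intro q hq j hj j' hj' he
    by_contra hne
    rcases Nat.lt_or_gt_of_ne hne with h | h
    · exact key q hq j j' h hj' he
    · exact key q hq j' j h hj he.symm

/-- The quotient by `e` is the position on a cycle of jumps of size `e`: each jump advances it by
one modulo `L`. -/
theorem val_add_mul_pow_div {L e : ℕ} [NeZero (L * e)] (he : 0 < e) (w : ZMod (L * e)) (j : ℕ) :
    (w + j * (e : ZMod (L * e))).val / e = (w.val / e + j) % L := by
  have h : w + j * (e : ZMod (L * e)) = ((w.val + j * e : ℕ) : ZMod (L * e)) := by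
    push_cast; rw [ZMod.natCast_zmod_val]
  rw [h, ZMod.val_natCast, Nat.mod_mul_left_div_self, Nat.add_mul_div_right _ _ he]

end Rainbow
-- Upper bounds from level colorings
namespace Rainbow

open Finset

theorem clog_one_mul_pow {d : ℕ} (hd : 1 < d) (m : ℕ) : Nat.clog d (1 * d ^ m) = m := by
  rw [one_mul, Nat.clog_pow d m hd]

theorem clog_mul_pow {r d : ℕ} (hr : 2 ≤ r) (hrd : r < d) (m : ℕ) :
    Nat.clog d (r * d ^ m) = m + 1 := by
  have hd : 1 < d := by omega
  have hp : 0 < d ^ m := pow_pos (by omega) m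
  refine le_antisymm ?_ ?_
  · rw [Nat.clog_le_iff_le_pow hd, pow_succ, mul_comm]
    exact Nat.mul_le_mul_left _ hrd.le
  · rw [Nat.succ_le_iff, Nat.lt_clog_iff_pow_lt hd]
    nlinarith

theorem lt_clog_cases {r d m i : ℕ} (hr : 1 ≤ r) (hrd : r < d)
    (hi : i < Nat.clog d (r * d ^ m)) : i < m ∨ i = m ∧ 2 ≤ r := by
  rcases hr.eq_or_lt with rfl | hr
  · rw [clog_one_mul_pow hrd] at hi
    exact Or.inl hi
  · rw [clog_mul_pow hr hrd] at hi
    omega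

theorem two_mul_pow_le {r d m : ℕ} (hr : 1 ≤ r) (hrd : r < d) :
    ∀ i < Nat.clog d (r * d ^ m), 2 * d ^ i ≤ r * d ^ m := by
  intro i hi
  rcases lt_clog_cases hr hrd hi with h | ⟨rfl, h⟩
  · calc 2 * d ^ i ≤ d * d ^ i := Nat.mul_le_mul_right _ (by omega)
      _ = d ^ (i + 1) := by ring
      _ ≤ d ^ m := Nat.pow_le_pow_right (by omega) h
      _ ≤ _ := Nat.le_mul_of_pos_left _ hr
  · exact Nat.mul_le_mul_right _ h

theorem one_lt_mul_pow {r d m : ℕ} (hr : 1 ≤ r) (hd : 1 < d) (hm : 1 ≤ m) : 1 < r * d ^ m :=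
  (Nat.one_lt_pow (by omega) hd).trans_le (Nat.le_mul_of_pos_left _ hr)

/-- Pads a digit vector for `G(r d^m, d)` to `m + 1` digits. -/
theorem exists_padded_digits {r d m : ℕ} (hr : 1 ≤ r) (hrd : r < d) (a : ℕ → ℤ) :
    ∃ b : ℕ → ℤ,
      ∑ i ∈ range (Nat.clog d (r * d ^ m)), a i * (d : ℤ) ^ i =
        ∑ i ∈ range (m + 1), b i * (d : ℤ) ^ i ∧
      ∑ i ∈ range (Nat.clog d (r * d ^ m)), (a i).natAbs = ∑ i ∈ range (m + 1), (b i).natAbs := by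
  rcases hr.eq_or_lt with rfl | hr
  · refine ⟨fun i => if i < m then a i else 0, ?_⟩
    rw [clog_one_mul_pow hrd, sum_range_succ, sum_range_succ]
    constructor
    · simp only [lt_irrefl, if_false, zero_mul, add_zero]
      exact sum_congr rfl fun i hi => by rw [if_pos (mem_range.1 hi)]
    · simp only [lt_irrefl, if_false, Int.natAbs_zero, add_zero]
      exact sum_congr rfl fun i hi => by rw [if_pos (mem_range.1 hi)]
  · rw [clog_mul_pow hr hrd]
    exact ⟨a, rfl, rfl⟩

theorem IsGeodesicDigits.of_modEq {r d m : ℕ} {x : ZMod (r * d ^ m)} {a b : ℕ → ℤ}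
    (ha : IsGeodesicDigits (r * d ^ m) d x a) {s : ℤ}
    (hs : ∑ i ∈ range (Nat.clog d (r * d ^ m)), a i * (d : ℤ) ^ i =
      ∑ i ∈ range (Nat.clog d (r * d ^ m)), b i * (d : ℤ) ^ i + s * (r * d ^ m))
    (hle : ∑ i ∈ range (Nat.clog d (r * d ^ m)), (b i).natAbs ≤
      ∑ i ∈ range (Nat.clog d (r * d ^ m)), (a i).natAbs) :
    IsGeodesicDigits (r * d ^ m) d x b := by
  refine ⟨?_, fun c hc => hle.trans (ha.2 c hc)⟩
  have hN : ((r : ZMod (r * d ^ m)) * (d : ZMod (r * d ^ m)) ^ m) = 0 := by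
    exact_mod_cast ZMod.natCast_self (r * d ^ m)
  have h := congrArg (Int.cast : ℤ → ZMod (r * d ^ m)) hs
  push_cast at h
  rw [hN, mul_zero, add_zero] at h
  rw [← h, ha.1]

theorem exists_balanced_geodesicDigits {r d m : ℕ} (hr : 1 ≤ r) (hrd : r < d) (hm : 1 ≤ m)
    (x : ZMod (r * d ^ m)) :
    ∃ a, IsGeodesicDigits (r * d ^ m) d x a ∧
      ∀ i < Nat.clog d (r * d ^ m), (a i).natAbs ≤ if i < m then d / 2 else r / 2 := by
  have hN := one_lt_mul_pow hr (by omega : 1 < d) hm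
  have : NeZero (r * d ^ m) := ⟨by omega⟩
  obtain ⟨a, ha⟩ := exists_isGeodesicDigits (by omega : 1 < d) hN x
  obtain ⟨a', hsum, hcost⟩ := exists_padded_digits (m := m) hr hrd a
  obtain ⟨b, ⟨s, hs⟩, hle, hb, hbm⟩ := exists_balanced_digits (by omega : 1 ≤ d) hr m a'
  refine ⟨b, ha.of_modEq (s := s) ?_ ?_, ?_⟩
  · rw [hsum, hs]
    congr 1
    rcases hr.eq_or_lt with rfl | hr
    -- For `r = 1` there is no level `m`; the bound `2 * |b m| ≤ 1` kills the padding digit.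
    · rw [clog_one_mul_pow hrd, sum_range_succ, show b m = 0 by omega, zero_mul, add_zero]
    · rw [clog_mul_pow hr hrd]
  · rw [hcost]
    refine le_trans ?_ hle
    rcases hr.eq_or_lt with rfl | hr
    · rw [clog_one_mul_pow hrd, sum_range_succ]; omega
    · rw [clog_mul_pow hr hrd]
  · intro i hi
    rcases lt_clog_cases hr hrd hi with h | ⟨rfl, -⟩
    · rw [if_pos h]
      have := hb i h
      omega
    · rw [if_neg (lt_irrefl _)]; omega

theorem val_div_lt {r d m i : ℕ} (hi : i ≤ m) (hr : 1 ≤ r) (hd : 0 < d)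
    (x : ZMod (r * d ^ m)) : x.val / d ^ i < r * d ^ (m - i) := by
  have hp : 0 < d ^ m := pow_pos hd m
  have : NeZero (r * d ^ m) := ⟨by positivity⟩
  rw [Nat.div_lt_iff_lt_mul (pow_pos hd i), mul_assoc, ← pow_add, Nat.sub_add_cancel hi]
  exact x.val_lt

theorem val_add_mul_pow_level {r d m i : ℕ} (hi : i ≤ m) (hr : 1 ≤ r) (hd : 0 < d)
    (x : ZMod (r * d ^ m)) (j : ℕ) :
    (x + j * (d : ZMod (r * d ^ m)) ^ i).val / d ^ i =
      (x.val / d ^ i + j) % (r * d ^ (m - i)) := by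
  have hN : r * d ^ m = r * d ^ (m - i) * d ^ i := by
    rw [mul_assoc, ← pow_add, Nat.sub_add_cancel hi]
  have hp : 0 < d ^ m := pow_pos hd m
  have hne : r * d ^ m ≠ 0 := by positivity
  revert x
  rw [hN] at hne ⊢
  intro x
  have : NeZero (r * d ^ (m - i) * d ^ i) := ⟨hne⟩
  have h := val_add_mul_pow_div (pow_pos hd i) x j
  push_cast at h
  exact h

theorem src_le_of_hasWindowColoring {r d m C C' : ℕ} (hr : 1 ≤ r) (hrd : r < d) (hd : 3 ≤ d)
    (hm : 1 ≤ m) (hC : ∀ i < m, HasWindowColoring (r * d ^ (m - i)) (d / 2) C)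
    (hC' : 2 ≤ r → HasWindowColoring r (r / 2) C') :
    src (recursiveCirculant (r * d ^ m) d) ≤ C * m + C' := by
  have hp : ∀ i, 0 < d ^ i := fun i => pow_pos (by omega) i
  have key : ∀ i, ∃ g : ℕ → ℕ, i < Nat.clog d (r * d ^ m) →
      (∀ x < r * d ^ (m - i), g x < if i < m then C else C') ∧
      ∀ q < r * d ^ (m - i), ∀ j < (if i < m then d / 2 else r / 2),
        ∀ j' < (if i < m then d / 2 else r / 2),
        g ((q + j) % (r * d ^ (m - i))) = g ((q + j') % (r * d ^ (m - i))) → j = j' := by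
    intro i
    by_cases hi : i < Nat.clog d (r * d ^ m)
    · rcases lt_clog_cases hr hrd hi with h | ⟨rfl, h⟩
      · obtain ⟨g, hg⟩ := hC i h
        exact ⟨g, fun _ => by simpa [h] using hg⟩
      · obtain ⟨g, hg⟩ := hC' h
        exact ⟨g, fun _ => by simpa using hg⟩
    · exact ⟨0, fun h => absurd h hi⟩
  choose g hg using key
  have hle : ∀ i < Nat.clog d (r * d ^ m), i ≤ m := fun i hi => by
    rcases lt_clog_cases hr hrd hi with h | h <;> omega
  have hlt : ∀ i < Nat.clog d (r * d ^ m), ∀ x : ZMod (r * d ^ m),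
      g i (x.val / d ^ i) < if i < m then C else C' := fun i hi x =>
    (hg i hi).1 _ (val_div_lt (hle i hi) hr (by omega) x)
  refine src_le_of_level_coloring (by omega) (two_mul_pow_le hr hrd)
    -- Level `i < m` owns the colors in `[i * C, (i + 1) * C)`, and the top level the `C'` colors
    -- from `m * C` on.
    (fun i x => i * C + g i (x.val / d ^ i)) ?_ ?_
  · intro i hi x
    have h := hlt i hi x
    have him := hle i hi
    split_ifs at h with h'
    · nlinarith
    · obtain rfl : i = m := by omega
      nlinarith
  · intro x
    obtain ⟨a, ha, hb⟩ := exists_balanced_geodesicDigits hr hrd hm x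
    refine ⟨a, ha, ?_, ?_⟩
    · have hinj : ∀ i < Nat.clog d (r * d ^ m), ∀ i' < Nat.clog d (r * d ^ m),
          ∀ y y' : ZMod (r * d ^ m),
          i * C + g i (y.val / d ^ i) = i' * C + g i' (y'.val / d ^ i') → ¬ i < i' := by
        intro i hi i' hi' y y' he hlt'
        have h := hlt i hi y
        have him' := hle i' hi'
        rw [if_pos (by omega)] at h
        nlinarith
      intro i hi i' hi' _ _ y y' he
      have h1 := hinj i hi i' hi' y y' he
      have h2 := hinj i' hi' i hi y' y he.symm
      omega
    · intro i hi h2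
      have hbi := hb i hi
      constructor
      -- Strict because `d ≥ 3` below the top, while on the top level two steps force `r / 2 ≥ 2`.
      · have h : 2 * d ^ i < r * d ^ m := by
          rcases lt_clog_cases hr hrd hi with h | ⟨rfl, h⟩
          · calc 2 * d ^ i < d * d ^ i := Nat.mul_lt_mul_of_pos_right (by omega) (hp i)
              _ = d ^ (i + 1) := by ring
              _ ≤ d ^ m := Nat.pow_le_pow_right (by omega) h
              _ ≤ _ := Nat.le_mul_of_pos_left _ hr
          · rw [if_neg (lt_irrefl _)] at hbi
            exact Nat.mul_lt_mul_of_pos_right (by omega) (hp i)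
        have := natCast_ne_zero_of_lt (by have := hp i; omega) h
        push_cast at this
        exact this
      · intro w j hj j' hj' he
        rw [val_add_mul_pow_level (hle i hi) hr (by omega),
          val_add_mul_pow_level (hle i hi) hr (by omega)] at he
        exact (hg i hi).2 _ (val_div_lt (hle i hi) hr (by omega) w) j (by omega) j' (by omega)
          (Nat.add_left_cancel he)

theorem src_two_pow_le {m : ℕ} (hm : 1 ≤ m) :
    src (recursiveCirculant (2 ^ m) 2) ≤ (m + 1) / 2 := by
  have hn : Nat.clog 2 (1 * 2 ^ m) = m := clog_one_mul_pow one_lt_two m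
  have hN := one_lt_mul_pow le_rfl one_lt_two hm
  rw [← one_mul (2 ^ m)]
  have : NeZero (1 * 2 ^ m) := ⟨by omega⟩
  refine src_le_of_level_coloring one_lt_two (two_mul_pow_le le_rfl one_lt_two)
    (fun i _ => i / 2) ?_ ?_
  · intro i hi _
    omega
  · intro x
    obtain ⟨a, ha⟩ := exists_isGeodesicDigits one_lt_two hN x
    obtain ⟨b, ⟨s, hs⟩, hc, hb1, hb⟩ := exists_sparse_digits m a
    refine ⟨b, ha.of_modEq (s := s) ?_ ?_, ?_, ?_⟩
    · rw [hn]; push_cast; rw [hs, one_mul]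
    · rwa [hn]
    · rw [hn]
      exact fun i hi i' hi' h h' _ _ he => hb i hi i' hi' h h' he
    · rw [hn]
      intro i hi h2
      have := hb1 i hi
      omega

/-! ### Lower bounds from distances -/

theorem le_rc_of_forall_digits {N d : ℕ} [NeZero N] (hd : 1 < d) (hN : 1 < N) {k : ℕ} (X : ℤ)
    (H : ∀ (a : ℕ → ℤ) (s : ℤ), ∑ i ∈ range (Nat.clog d N), a i * (d : ℤ) ^ i = X + s * N →
      k ≤ ∑ i ∈ range (Nat.clog d N), (a i).natAbs) :
    k ≤ rc (recursiveCirculant N d) := by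
  have hG := connected_recursiveCirculant hd hN
  refine le_trans ?_ (dist_le_rc hG 0 (X : ZMod N))
  obtain ⟨p, hp⟩ := hG.exists_walk_length_eq_dist 0 (X : ZMod N)
  obtain ⟨a, ha, hl⟩ := exists_digits_of_walk p
  rw [← hp]
  refine le_trans ?_ hl
  have h : ((∑ i ∈ range (Nat.clog d N), a i * (d : ℤ) ^ i - X : ℤ) : ZMod N) = 0 := by
    push_cast
    rw [ha]; ring
  obtain ⟨s, hs⟩ := (ZMod.intCast_zmod_eq_zero_iff_dvd _ N).1 h
  exact H a s (by linear_combination hs)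

theorem le_rc_of_odd {r k m : ℕ} (hr : 1 ≤ r) (hrk : r < 2 * k + 1) (hm : 1 ≤ m) :
    k * m + r / 2 ≤ rc (recursiveCirculant (r * (2 * k + 1) ^ m) (2 * k + 1)) := by
  have hN := one_lt_mul_pow hr (by omega : 1 < 2 * k + 1) hm
  have : NeZero (r * (2 * k + 1) ^ m) := ⟨by omega⟩
  refine le_rc_of_forall_digits (by omega) hN (∑ i ∈ range m, (k : ℤ) * (2 * k + 1 : ℤ) ^ i +
    (r / 2 : ℕ) * (2 * k + 1 : ℤ) ^ m) fun a s h => ?_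
  obtain ⟨b, hsum, hcost⟩ := exists_padded_digits (m := m) hr hrk a
  rw [hcost]
  refine le_sum_natAbs_of_odd m b s ?_
  rw [hsum] at h
  push_cast at h ⊢
  exact h

theorem le_rc_two_pow {m : ℕ} (hm : 1 ≤ m) : m / 2 ≤ rc (recursiveCirculant (2 ^ m) 2) := by
  have hN : 1 < 2 ^ m := Nat.one_lt_pow (by omega) one_lt_two
  have : NeZero (2 ^ m) := ⟨by omega⟩
  refine le_rc_of_forall_digits one_lt_two hN (∑ i ∈ range (m / 2), (4 : ℤ) ^ i) fun a s h => ?_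
  rw [Nat.clog_pow 2 m one_lt_two] at h ⊢
  exact le_sum_natAbs_of_two m a s (by exact_mod_cast h)

theorem rc_le_src_recursiveCirculant {r d m : ℕ} (hr : 1 ≤ r) (hd : 1 < d) (hm : 1 ≤ m) :
    rc (recursiveCirculant (r * d ^ m) d) ≤ src (recursiveCirculant (r * d ^ m) d) := by
  have hN := one_lt_mul_pow hr hd hm
  have : NeZero (r * d ^ m) := ⟨by omega⟩
  exact rc_le_src (connected_recursiveCirculant hd hN)

/-! ### Colorings for each case of the theorem -/

theorem hasWindowColoring_even_base {r d e : ℕ} (hd : Even d) (hd0 : 2 ≤ d) (he : 1 ≤ e) :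
    HasWindowColoring (r * d ^ e) (d / 2) (d / 2) := by
  refine hasWindowColoring_of_dvd (by omega) ?_ le_rfl
  obtain ⟨k, rfl⟩ := hd
  exact Dvd.dvd.mul_left (((Dvd.intro_left 2 (by omega))).trans (dvd_pow_self _ (by omega))) _

theorem hasWindowColoring_of_half_le {r d e : ℕ} (hr : 1 ≤ r) (h : d / 2 ≤ r) :
    HasWindowColoring (r * d ^ e) (d / 2) r :=
  hasWindowColoring_of_dvd hr (Dvd.intro _ rfl) h

/-- Write `d = 2 * k + 1`. Since `d ≡ 1` modulo `k`, the cycle length is `r` modulo `k`, leaving `r`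
edges with private colors. -/
theorem hasWindowColoring_of_lt_half {r d e : ℕ} (hr : 1 ≤ r) (hd : Odd d) (h : r < d / 2)
    (he : 1 ≤ e) : HasWindowColoring (r * d ^ e) (d / 2) (d / 2 + r) := by
  obtain ⟨k, rfl⟩ := hd
  have hk : (2 * k + 1) / 2 = k := by omega
  rw [hk] at h ⊢
  have hmod : r * (2 * k + 1) ^ e % k = r := by
    have : r * (2 * k + 1) ^ e ≡ r * 1 ^ e [MOD k] := by
      refine Nat.ModEq.mul_left _ (Nat.ModEq.pow _ ?_)
      simp [Nat.ModEq]
    rw [one_pow, mul_one] at this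
    exact Eq.trans this (Nat.mod_eq_of_lt h)
  have hdiv := Nat.div_add_mod' (r * (2 * k + 1) ^ e) k
  rw [hmod] at hdiv
  rw [← hdiv]
  refine hasWindowColoring_add ((Nat.one_le_div_iff (by omega)).2 ?_)
  calc k ≤ 2 * k + 1 := by omega
    _ ≤ (2 * k + 1) ^ e := Nat.le_self_pow (by omega) _
    _ ≤ _ := Nat.le_mul_of_pos_left _ hr

theorem hasWindowColoring_ceil_half {r : ℕ} (hr : 1 ≤ r) :
    HasWindowColoring r (r / 2) ((r + 1) / 2) := by
  obtain ⟨h, rfl | rfl⟩ := Nat.even_or_odd' r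
  · exact hasWindowColoring_of_dvd (by omega) (Dvd.intro_left 2 (by omega)) (by omega)
  · rw [show (2 * h + 1) / 2 = h by omega, show (2 * h + 1 + 1) / 2 = h + 1 by omega]
    exact hasWindowColoring_odd h

/-- For `r` equal to 2 or 3 windows are single edges, so one color suffices and the ceiling improves
to a floor. -/
theorem hasWindowColoring_floor_half {r : ℕ} (hr : 2 ≤ r) (h3 : r ≤ 3) :
    HasWindowColoring r (r / 2) (r / 2) := by
  rw [show r / 2 = 1 by omega]
  exact hasWindowColoring_of_dvd one_pos (one_dvd r) le_rfl

/-- The bounds on `src (G(r d^m, d))`, given a coloring of the cycles of the top level. -/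
theorem src_le_cases {r d m C' : ℕ} (hr : 1 ≤ r) (hrd : r < d) (hd : 3 ≤ d) (hm : 1 ≤ m)
    (hC' : 2 ≤ r → HasWindowColoring r (r / 2) C') :
    (Even d → src (recursiveCirculant (r * d ^ m) d) ≤ d / 2 * m + C') ∧
    (d / 2 ≤ r → src (recursiveCirculant (r * d ^ m) d) ≤ r * m + C') ∧
    (Odd d → r < d / 2 → src (recursiveCirculant (r * d ^ m) d) ≤ (d / 2 + r) * m + C') :=
  ⟨fun h => src_le_of_hasWindowColoring hr hrd hd hm
      (fun _ _ => hasWindowColoring_even_base h (by omega) (by omega)) hC',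
    fun h => src_le_of_hasWindowColoring hr hrd hd hm
      (fun _ _ => hasWindowColoring_of_half_le hr h) hC',
    fun h h' => src_le_of_hasWindowColoring hr hrd hd hm
      (fun _ _ => hasWindowColoring_of_lt_half hr h h' (by omega)) hC'⟩

end Rainbow

theorem theorem3 (r d m : ℕ) (hr : 1 ≤ r) (hrd : r < d) (hm : 1 ≤ m) :
    -- (i)
    ((4 ≤ r → 5 ≤ d →
      (Rainbow.rc (Rainbow.recursiveCirculant (r * d ^ m) d) ≤
        Rainbow.src (Rainbow.recursiveCirculant (r * d ^ m) d)) ∧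
      (Even d →
        Rainbow.src (Rainbow.recursiveCirculant (r * d ^ m) d) ≤ d / 2 * m + (r + 1) / 2) ∧
      (Odd d → r = d / 2 →
        Rainbow.src (Rainbow.recursiveCirculant (r * d ^ m) d) ≤ d / 2 * m + (r + 1) / 2) ∧
      (Odd d → r < d / 2 →
        Rainbow.src (Rainbow.recursiveCirculant (r * d ^ m) d) ≤
          (d / 2 + r) * m + (r + 1) / 2) ∧
      (Odd d → d / 2 < r →
        Rainbow.src (Rainbow.recursiveCirculant (r * d ^ m) d) ≤ r * m + (r + 1) / 2) ∧
      (d = 2 * r + 1 → Even r →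
        Rainbow.rc (Rainbow.recursiveCirculant (r * d ^ m) d) = r * m + r / 2 ∧
        Rainbow.src (Rainbow.recursiveCirculant (r * d ^ m) d) = r * m + r / 2))) ∧
    -- (ii)
    ((r ≤ 3 → 4 ≤ d →
      (Rainbow.rc (Rainbow.recursiveCirculant (r * d ^ m) d) ≤
        Rainbow.src (Rainbow.recursiveCirculant (r * d ^ m) d)) ∧
      (Even d →
        Rainbow.src (Rainbow.recursiveCirculant (r * d ^ m) d) ≤ d / 2 * m + r / 2) ∧
      (Odd d → r = d / 2 →
        Rainbow.src (Rainbow.recursiveCirculant (r * d ^ m) d) ≤ d / 2 * m + r / 2) ∧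
      (Odd d → r < d / 2 →
        Rainbow.src (Rainbow.recursiveCirculant (r * d ^ m) d) ≤ (d / 2 + r) * m + r / 2) ∧
      (Odd d → d / 2 < r →
        Rainbow.src (Rainbow.recursiveCirculant (r * d ^ m) d) ≤ r * m + r / 2) ∧
      (r = 3 → d = 7 →
        Rainbow.rc (Rainbow.recursiveCirculant (r * d ^ m) d) = 3 * m + 1 ∧
        Rainbow.src (Rainbow.recursiveCirculant (r * d ^ m) d) = 3 * m + 1))) ∧
    -- (iii)
    (d = 3 →
      Rainbow.rc (Rainbow.recursiveCirculant (r * 3 ^ m) 3) = m + r / 2 ∧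
      Rainbow.src (Rainbow.recursiveCirculant (r * 3 ^ m) 3) = m + r / 2) ∧
    -- (iv)
    (d = 2 →
      (m / 2 ≤ Rainbow.rc (Rainbow.recursiveCirculant (2 ^ m) 2) ∧
        Rainbow.rc (Rainbow.recursiveCirculant (2 ^ m) 2) ≤
          Rainbow.src (Rainbow.recursiveCirculant (2 ^ m) 2) ∧
        Rainbow.src (Rainbow.recursiveCirculant (2 ^ m) 2) ≤ (m + 1) / 2) ∧
      (Even m →
        Rainbow.rc (Rainbow.recursiveCirculant (2 ^ m) 2) = m / 2 ∧
        Rainbow.src (Rainbow.recursiveCirculant (2 ^ m) 2) = m / 2)) := by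
  have hd : 1 < d := by omega
  have hrs := Rainbow.rc_le_src_recursiveCirculant hr hd hm
  refine ⟨fun h4 h5 => ?_, fun h3 h4 => ?_, ?_, ?_⟩
  · obtain ⟨he, hge, hlt⟩ := Rainbow.src_le_cases hr hrd (by omega) hm
      fun _ => Rainbow.hasWindowColoring_ceil_half hr
    refine ⟨hrs, he, ?_, hlt, fun _ h => hge h.le, ?_⟩
    · rintro - rfl
      exact hge le_rfl
    · rintro rfl hev
      -- Here `k = d / 2 = r`, and even `r` makes the ceiling of `r / 2` equal to its floor, so the
      -- bounds meet.
      have hlow := Rainbow.le_rc_of_odd hr hrd hm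
      have hup := hge (by omega)
      rw [show (r + 1) / 2 = r / 2 by obtain ⟨k, rfl⟩ := hev; omega] at hup
      omega
  · obtain ⟨he, hge, hlt⟩ := Rainbow.src_le_cases hr hrd (by omega) hm
      fun h => Rainbow.hasWindowColoring_floor_half h h3
    refine ⟨hrs, he, ?_, hlt, fun _ h => hge h.le, ?_⟩
    · rintro - rfl
      exact hge le_rfl
    · rintro rfl rfl
      have hlow := Rainbow.le_rc_of_odd (k := 3) hr hrd hm
      have hup := hge (by omega)
      simp only [Nat.reduceMul, Nat.reduceAdd, Nat.reduceDiv] at hlow hup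
      omega
  · rintro rfl
    have hlow := Rainbow.le_rc_of_odd (k := 1) hr hrd hm
    have hup := Rainbow.src_le_of_hasWindowColoring (C := 1) hr hrd le_rfl hm
      (fun _ _ => Rainbow.hasWindowColoring_of_dvd one_pos (one_dvd _) le_rfl)
      fun h => Rainbow.hasWindowColoring_floor_half h (by omega)
    simp only [Nat.reduceMul, Nat.reduceAdd, one_mul] at hlow hup
    omega
  · rintro rfl
    obtain rfl : r = 1 := by omega
    rw [one_mul] at hrs
    have hlow := Rainbow.le_rc_two_pow hm
    have hup := Rainbow.src_two_pow_le hm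
    refine ⟨⟨hlow, hrs, hup⟩, ?_⟩
    rintro ⟨k, rfl⟩
    omega
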